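/- Let $\mathcal M$ be a finite regular matroid with ground set $E$, and let $A$ be a totally unimodular real matrix, with columns $c_e$ indexed by $E$, that represents $\mathcal M$ (a set $I\subseteq E$ is independent iff the columns $(c_e)_{e\in I}$ are linearly independent). Equip $\mathbb R^E$ with the Euclidean inner product and put $$\mathcal F=\ker A\subseteq\mathbb R^E,\qquad \Lambda=\mathcal F\cap\mathbb Z^E,\qquad V_0=\{x\in\mathcal F:\ \|x\|\le\|x-\mu\|\ \text{for all }\mu\in\Lambda\}.$$ Let $\mathcal{FP}(\mathcal M)$ be the poset of nonempty faces of $V_0$ (including $V_0$ itself), ordered by inclusion and graded by dimension; the codimension of a face $F$ is $\operatorname{codim}F=\dim\mathcal F-\dim F$. A submatroid $\mathcal N$ of $\mathcal M$ is a subset $E(\mathcal N)\subseteq E$ with the induced independent sets, and $\operatorname{genus}(\mathcal N)=\dim\ker A_{\mathcal N}$, where $A_{\mathcal N}$ is the submatrix of $A$ formed by the columns labelled by $E(\mathcal N)$. An orientation $D:E(\mathcal N)\to\{\pm1\}$ is strongly connected (totally cyclic) if for every $e\in E(\mathcal N)$ there is $z\in(\mathbb Z_{\ge0})^{E(\mathcal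 N)}$ such that $e+z$ lies in the kernel of the matrix obtained from $A_{\mathcal N}$ by multiplying the column of each $f\in E(\mathcal N)$ by $D(f)$; here $e$ also denotes the corresponding standard basis vector. Let $\mathcal{SC}(\mathcal M)$ be the set of pairs $(\mathcal N,D)$ of a submatroid $\mathcal N$ of $\mathcal M$ and a strongly connected orientation $D$ of $\mathcal N$, ordered by $(\mathcal N,D)\le(\mathcal N',D')$ iff $\mathcal N'$ is a submatroid of $\mathcal N$ and $D'=D|_{E(\mathcal N')}$, and graded by $\deg(\mathcal N,D)=\operatorname{genus}(\mathcal M)-\operatorname{genus}(\mathcal N)$. Let $\Xi$ be the set of circuits in $\Lambda$, that is, of all nonzero $\gamma\in\mathcal F$ with entries in $\{-1,0,1\}$ whose support $\operatorname{supp}\gamma=\{e:\gamma_e\ne0\}$ is a circuit of $\mathcal M$. For $\gamma\in\Xi$ let $F_\gamma=\{x\in\mathcal F:\ 2\langle x,\gamma\rangle=\|\gamma\|^2\}$, and for a nonempty face $F$ of $V_0$ let $\mathcal U(F)=\{\gamma\in\Xi:\ F\subseteq F_\gamma\}$. **Theorem.** Both posets are graded in the sense that the dimension on $\mathcal{FP}(\mathcal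 M)$ and the degree on $\mathcal{SC}(\mathcal M)$ are strictly increasing. There is an isomorphism of posets $\phi:\mathcal{FP}(\mathcal M)\to\mathcal{SC}(\mathcal M)$ such that for every face $F\in\mathcal{FP}(\mathcal M)$, writing $\phi(F)=(\mathcal N,D)$: 1. $E(\mathcal N)=\bigcup_{\gamma\in\mathcal U(F)}\operatorname{supp}\gamma$, and $D(e)=\operatorname{sgn}(\gamma_e)$ for all $\gamma\in\mathcal U(F)$ and $e\in\operatorname{supp}\gamma$; 2. $\operatorname{codim}F=\operatorname{genus}(\mathcal N)$; equivalently, $\dim F=\deg\phi(F)$, so $\phi$ is an isomorphism of graded posets. -/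

import Mathlib

noncomputable section

namespace RegularFlow

/-- The real matrix `A` represents the matroid `M`: the ground set of `M` is the set of all column
labels, and a set of labels is independent iff the corresponding columns are linearly
independent. -/
def Represents {ρ E : Type*} (A : Matrix ρ E ℝ) (M : Matroid E) : Prop :=
  M.E = Set.univ ∧ ∀ I : Set E, M.Indep I ↔ LinearIndepOn ℝ A.col I

section Flows

variable {ρ E : Type*} [Fintype E] (A : Matrix ρ E ℝ)

/-- The space of real flows, `ker A`, with the Euclidean inner product. -/
def flowSpace : Submodule ℝ (EuclideanSpace ℝ E) :=
  (LinearMap.ker A.mulVecLin).comap (WithLp.linearEquiv 2 ℝ (E → ℝ)).toLinearMap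

/-- The genus: the dimension of the space of flows. -/
def genus : ℕ := Module.finrank ℝ (flowSpace A)

/-- The lattice of integer flows, `ker A ∩ ℤ^E`. -/
def flowLattice : AddSubgroup (EuclideanSpace ℝ E) where
  carrier := {x | x ∈ flowSpace A ∧ ∀ e, ∃ n : ℤ, x e = n}
  zero_mem' := ⟨zero_mem _, fun _ => ⟨0, by simp⟩⟩
  add_mem' := by
    rintro x y ⟨hx, hx'⟩ ⟨hy, hy'⟩
    refine ⟨add_mem hx hy, fun e => ?_⟩
    obtain ⟨m, hm⟩ := hx' e
    obtain ⟨n, hn⟩ := hy' e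
    exact ⟨m + n, by simp [hm, hn]⟩
  neg_mem' := by
    rintro x ⟨hx, hx'⟩
    refine ⟨neg_mem hx, fun e => ?_⟩
    obtain ⟨m, hm⟩ := hx' e
    exact ⟨-m, by simp [hm]⟩

/-- The Voronoi cell of `v`: the flows that are at least as close to `v` as to every other
lattice point. -/
def voronoiCell (v : EuclideanSpace ℝ E) : Set (EuclideanSpace ℝ E) :=
  {x | x ∈ flowSpace A ∧ ∀ μ ∈ flowLattice A, ‖x - v‖ ≤ ‖x - μ‖}

/-- The poset of nonempty faces of the Voronoi cell of the origin, ordered by inclusion. A nonempty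
face is the set of points of the cell at which some linear functional attains its maximum over the
cell (the zero functional gives the cell itself). -/
abbrev FacePoset : Type _ :=
  {F : Set (EuclideanSpace ℝ E) // F.Nonempty ∧ IsExposed ℝ (voronoiCell A 0) F}

/-- The dimension of a face: the dimension of its affine hull. -/
def faceDim (F : FacePoset A) : ℕ := Module.finrank ℝ (vectorSpan ℝ F.1)

/-- The codimension of a face in the space of flows. -/
def faceCodim (F : FacePoset A) : ℤ :=
  (Module.finrank ℝ (flowSpace A) : ℤ) - (faceDim A F : ℤ)

/-- The support of a vector. -/
def supp (x : EuclideanSpace ℝ E) : Set E := {e | x e ≠ 0}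

/-- An Eulerian flow: a nonzero flow with all entries in `{-1, 0, 1}`. -/
def IsEulerian (x : EuclideanSpace ℝ E) : Prop :=
  x ∈ flowSpace A ∧ x ≠ 0 ∧ ∀ e, x e = -1 ∨ x e = 0 ∨ x e = 1

/-- The circuits in the lattice of flows: the Eulerian flows supported on a circuit of the
matroid. -/
def circuits (M : Matroid E) : Set (EuclideanSpace ℝ E) :=
  {γ | IsEulerian A γ ∧ M.IsCircuit (supp γ)}

/-- The hyperplane `2⟨x, γ⟩ = ‖γ‖²` of the space of flows. -/
def hyperplane (γ : EuclideanSpace ℝ E) : Set (EuclideanSpace ℝ E) :=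
  {x | x ∈ flowSpace A ∧ 2 * inner ℝ x γ = ‖γ‖ ^ 2}

/-- The circuits whose hyperplanes contain the face `F`. -/
def circuitsThrough (M : Matroid E) (F : FacePoset A) : Set (EuclideanSpace ℝ E) :=
  {γ | γ ∈ circuits A M ∧ F.1 ⊆ hyperplane A γ}

/-- The matrix `A^ε` in which the column of `e` is multiplied by the sign `ε e`. -/
def reorient {ρ E : Type*} (A : Matrix ρ E ℝ) (ε : E → ℤˣ) : Matrix ρ E ℝ :=
  Matrix.of fun i e => ((ε e : ℤ) : ℝ) * A i e

open Classical in
/-- Strong connectedness (total cyclicity) of the oriented matroid given by `A`: for every `e` there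
is a nonnegative integer vector `z` such that `e + z` is an integer flow. -/
def StronglyConnected : Prop :=
  ∀ e : E, ∃ z : E → ℕ,
    EuclideanSpace.single e (1 : ℝ) + WithLp.toLp 2 (fun f => (z f : ℝ)) ∈ flowLattice A

end Flows

section SC

variable {ρ E : Type*} [Fintype E]

/-- The submatrix of the columns labelled by `S`. -/
def columns {ρ E : Type*} (A : Matrix ρ E ℝ) (S : Set E) : Matrix ρ S ℝ :=
  A.submatrix id Subtype.val

open Classical in
/-- The pairs of a submatroid of `M` (a restriction of `M` to a subset of its ground set) and a
strongly connected orientation of it. -/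
@[ext] structure SC (A : Matrix ρ E ℝ) (M : Matroid E) where
  sub : Matroid E
  isRestriction : sub.IsRestriction M
  orient : sub.E → ℤˣ
  stronglyConnected : StronglyConnected (reorient (columns A sub.E) orient)

variable {A : Matrix ρ E ℝ} {M : Matroid E}

/-- `(N, D) ≤ (N', D')` iff `N'` is a submatroid of `N` and `D'` is induced from `D`. -/
instance : PartialOrder (SC A M) where
  le x y := y.sub.IsRestriction x.sub ∧
    ∀ (e : E) (hx : e ∈ x.sub.E) (hy : e ∈ y.sub.E), y.orient ⟨e, hy⟩ = x.orient ⟨e, hx⟩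
  le_refl x := ⟨Matroid.IsRestriction.refl, fun _ _ _ => rfl⟩
  le_trans x y z hxy hyz :=
    ⟨hyz.1.trans hxy.1, fun e hx hz =>
      (hyz.2 e (hyz.1.subset hz) hz).trans (hxy.2 e hx (hyz.1.subset hz))⟩
  le_antisymm x y hxy hyx := by
    obtain ⟨N, hN, D, hD⟩ := x
    obtain ⟨N', hN', D', hD'⟩ := y
    obtain rfl : N = N' := hyx.1.antisymm hxy.1
    obtain rfl : D = D' := funext fun e => (hxy.2 e.1 e.2 e.2).symm
    rfl

open Classical in
/-- The genus of the submatroid `N` of a pair `(N, D)`: the dimension of its space of flows. -/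
def SC.genus (x : SC A M) : ℕ := RegularFlow.genus (columns A x.sub.E)

/-- The degree of a pair `(N, D)`: the genus of `M` minus the genus of `N`. -/
def SC.degree (x : SC A M) : ℤ := (RegularFlow.genus A : ℤ) - (x.genus : ℤ)

end SC

end RegularFlow

end

/-! On flows, the support function of the Voronoi cell is half the ℓ¹-norm: the maximum of `2⟨x, w⟩`
over the cell is `∑ |w e|`. By total unimodularity and Cramer's rule, a flow of minimal support is a
multiple of a circuit with entries in {-1, 0, 1}; hence every flow is a positive combination of
circuits conforming to it. The cell satisfies `2⟨x, γ⟩ ≤ ‖γ‖² = ‖γ‖₁` for circuits, and ℓ¹-norms add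
along conformal sums, which gives the bound (`two_inner_le_oneNorm`). It is attained because the
projection of the cube [-1/2, 1/2]^E lies in the cell: take the projection of `sign(w)/2`.

Consequently every face is `faceSet A w` for a flow `w`, and inclusion of faces is reverse
conformity of flows (`faceSet_subset_faceSet_iff`), so faces correspond to sign vectors of flows.
These sign vectors are exactly the strongly connected pairs. The directions of a face are the flows
orthogonal to all flows supported on `supp w` (`vectorSpan_faceSet`), so its codimension is the
genus of that support. -/

noncomputable section

namespace RegularFlow

/-! ### Conformal decomposition of flows into circuits -/

section Circuits

variable {ρ E : Type*}

/-- The columns of a matrix being independent, some square submatrix on these columns is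
invertible. -/
theorem exists_isUnit_det_submatrix [Finite ρ] {ι : Type*} [Fintype ι] [DecidableEq ι]
    (B : Matrix ρ ι ℝ) (hB : LinearIndependent ℝ B.col) :
    ∃ g : ι → ρ, (B.submatrix g id).det ≠ 0 := by
  have := Fintype.ofFinite ρ
  obtain ⟨κ, a, ha, hspan, hli⟩ := exists_linearIndependent' ℝ B.row
  have := Finite.of_injective a ha
  have := Fintype.ofFinite κ
  have hrank : B.rank = Fintype.card ι := by
    rw [← Matrix.rank_transpose]
    exact LinearIndependent.rank_matrix (by simpa using hB)
  have hcard : Fintype.card κ = Fintype.card ι := by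
    rw [← hrank, Matrix.rank_eq_finrank_span_row, ← hspan]
    exact (finrank_span_eq_card hli).symm
  let σ := Fintype.equivOfCardEq hcard
  refine ⟨a ∘ σ.symm, ?_⟩
  have : LinearIndependent ℝ (B.submatrix (a ∘ σ.symm) id).row := hli.comp _ σ.symm.injective
  rw [Matrix.linearIndependent_rows_iff_isUnit, Matrix.isUnit_iff_isUnit_det] at this
  exact this.ne_zero

theorem mem_supp {x : EuclideanSpace ℝ E} {e : E} : e ∈ supp x ↔ x e ≠ 0 := Iff.rfl

/-- `u` conforms to `w` if the signs of `u` agree with those of `w` on the support of `u`. -/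
def Conforms (u w : EuclideanSpace ℝ E) : Prop := ∀ e, u e ≠ 0 → 0 < u e * w e

theorem Conforms.refl (u : EuclideanSpace ℝ E) : Conforms u u :=
  fun _ h => mul_self_pos.2 h

theorem Conforms.supp_subset {u w : EuclideanSpace ℝ E} (h : Conforms u w) : supp u ⊆ supp w :=
  fun e he hw => by simpa [hw] using h e he

theorem Conforms.trans {u v w : EuclideanSpace ℝ E} (h : Conforms u v) (h' : Conforms v w) :
    Conforms u w := by
  intro e he
  have h1 := h e he
  have h2 := h' e (h.supp_subset he)
  have h3 : 0 < v e ^ 2 := sq_pos_of_ne_zero (h.supp_subset he)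
  nlinarith [mul_pos h1 h2]

theorem Conforms.smul {u w : EuclideanSpace ℝ E} (h : Conforms u w) {a : ℝ} (ha : 0 < a) :
    Conforms (a • u) w := by
  intro e he
  have : u e ≠ 0 := fun h => he (by simp [h])
  simpa [mul_assoc] using mul_pos ha (h e this)

variable [Fintype E]

theorem mem_flowSpace_iff {A : Matrix ρ E ℝ} {x : EuclideanSpace ℝ E} :
    x ∈ flowSpace A ↔ ∀ i, ∑ e, A i e * x e = 0 := by
  simp [flowSpace, funext_iff, Matrix.mulVec, dotProduct]

theorem linearIndepOn_col_iff (A : Matrix ρ E ℝ) (I : Set E) :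
    LinearIndepOn ℝ A.col I ↔ ∀ x ∈ flowSpace A, supp x ⊆ I → x = 0 := by
  classical
  rw [linearIndepOn_iff'']
  constructor
  · intro h x hx hxI
    have hx' := mem_flowSpace_iff.1 hx
    have := h (Finset.univ.filter fun e => e ∈ supp x) (fun e => x e)
      (fun e he => hxI (by simpa using he)) (fun e he => by simpa [mem_supp] using he) (by
        ext i
        rw [Finset.sum_apply, Finset.sum_filter]
        refine (Finset.sum_congr rfl fun e _ => ?_).trans (hx' i)
        by_cases he : x e = 0 <;> simp [mem_supp, he, mul_comm])
    ext e
    by_contra he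
    exact he (this e (by simpa [mem_supp] using he))
  · intro h t g htI hg hsum e he
    have h0 := h (WithLp.toLp 2 g) (mem_flowSpace_iff.2 fun i => ?_) fun e he => htI ?_
    · simpa using congrArg (fun x : EuclideanSpace ℝ E => x e) h0
    · have := congrFun hsum i
      rw [Finset.sum_apply, Pi.zero_apply] at this
      rw [← this, ← Finset.sum_subset (Finset.subset_univ t)]
      · simp [Matrix.col, mul_comm]
      · intro e _ he
        simp [hg e he]
    · by_contra hne
      exact he (hg e hne)

theorem abs_eq_one_of_mem_range_signType {x : ℝ} (h : x ∈ Set.range (SignType.cast : SignType → ℝ))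
    (h0 : x ≠ 0) : |x| = 1 := by
  obtain ⟨s, rfl⟩ := h
  cases s <;> simp at h0 ⊢

/-- A flow of minimal support for a totally unimodular matrix has constant absolute value on its
support. -/
theorem abs_eq_abs_of_minimal_supp [Finite ρ] {A : Matrix ρ E ℝ} (hA : A.IsTotallyUnimodular)
    {u : EuclideanSpace ℝ E} (hu : u ∈ flowSpace A)
    (hmin : ∀ v ∈ flowSpace A, v ≠ 0 → supp v ⊆ supp u → supp v = supp u) {e f : E}
    (he : u e ≠ 0) (hf : u f ≠ 0) : |u e| = |u f| := by
  classical
  by_cases hef : e = f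
  · rw [hef]
  -- By minimality, deleting `f` from the support leaves independent columns, so the entries of `u`
  -- on `I` solve an invertible square system with right-hand side `-u f` times column `f`.
  let I : Set E := supp u \ {f}
  have hI : LinearIndepOn ℝ A.col I := by
    rw [linearIndepOn_col_iff]
    intro v hv hvI
    by_contra hv0
    have := hmin v hv hv0 (hvI.trans Set.sdiff_subset)
    exact (hvI (this.symm ▸ hf : f ∈ supp v)).2 rfl
  obtain ⟨g, hg⟩ := exists_isUnit_det_submatrix (A.submatrix id ((↑) : I → E)) hI
  set B : Matrix I I ℝ := (A.submatrix id ((↑) : I → E)).submatrix g id with hBdef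
  have hu' := mem_flowSpace_iff.1 hu
  have hBu : B.mulVec (fun i => u i) = (-u f) • fun i => A (g i) f := by
    ext i
    have h1 : ∑ e ∈ insert f (Finset.univ.filter fun e => e ∈ I), A (g i) e * u e = 0 := by
      rw [← hu' (g i)]
      refine Finset.sum_subset (Finset.subset_univ _) fun e _ he => ?_
      have : u e = 0 := by
        by_contra h
        apply he
        by_cases h' : e = f <;> simp [h', I, supp, h]
      simp [this]
    rw [Finset.sum_insert (by simp [I])] at h1
    have h2 : ∑ e ∈ Finset.univ.filter (fun e => e ∈ I), A (g i) e * u e =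
        ∑ e : I, A (g i) e * u e :=
      Finset.sum_subtype _ (fun e => Finset.mem_filter.trans (and_iff_right (Finset.mem_univ e))) _
    simp only [Matrix.mulVec, dotProduct, hBdef, Matrix.submatrix_apply, id, Pi.smul_apply,
      smul_eq_mul]
    linarith
  let j : I := ⟨e, he, hef⟩
  -- Cramer's rule; both determinants are nonzero minors of `A`, hence ±1.
  have hcr : B.det * u e = -u f * (B.updateCol j fun i => A (g i) f).det := by
    have := congrFun (congrArg (fun b => B.adjugate.mulVec b) hBu) j
    simp only [Matrix.mulVec_mulVec, Matrix.adjugate_mul, Matrix.smul_mulVec, Matrix.one_mulVec,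
      Matrix.mulVec_smul] at this
    rw [← Matrix.cramer_eq_adjugate_mulVec] at this
    simpa [Matrix.cramer_apply, j] using this
  rw [Matrix.isTotallyUnimodular_iff_fintype] at hA
  have hB1 : |B.det| = 1 := abs_eq_one_of_mem_range_signType (hA I g (↑)) hg
  have hup : (B.updateCol j fun i => A (g i) f) = A.submatrix g (Function.update (↑) j f) := by
    ext i k
    by_cases hk : k = j <;> simp [hk, hBdef]
  have hB2 : |(B.updateCol j fun i => A (g i) f).det| = 1 := by
    refine abs_eq_one_of_mem_range_signType (hup ▸ hA I g _) fun h => ?_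
    rw [h, mul_zero, mul_eq_zero] at hcr
    exact hcr.elim hg he
  have := congrArg abs hcr
  rwa [abs_mul, abs_mul, hB1, hB2, abs_neg, one_mul, mul_one] at this

theorem isCircuit_supp_of_minimal {A : Matrix ρ E ℝ} {M : Matroid E} (hM : Represents A M)
    {u : EuclideanSpace ℝ E} (hu : u ∈ flowSpace A) (hu0 : u ≠ 0)
    (hmin : ∀ v ∈ flowSpace A, v ≠ 0 → supp v ⊆ supp u → supp v = supp u) :
    M.IsCircuit (supp u) := by
  rw [Matroid.isCircuit_iff_minimal_not_indep (by simp [hM.1]), minimal_iff]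
  refine ⟨fun h => hu0 ?_, fun D hD hDu => ?_⟩
  · rw [hM.2, linearIndepOn_col_iff] at h
    exact h u hu subset_rfl
  · rw [hM.2, linearIndepOn_col_iff] at hD
    push Not at hD
    obtain ⟨v, hv, hvD, hv0⟩ := hD
    exact ((hmin v hv hv0 (hvD.trans hDu)).symm.subset.trans hvD).antisymm hDu

/-- Subtracting a suitable multiple of `v` from `u` loses a point of the support and keeps the
signs. -/
theorem exists_sub_smul_conforms {u v : EuclideanSpace ℝ E} (hsupp : supp v ⊆ supp u)
    (hpos : ∃ e, 0 < v e * u e) :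
    ∃ a : ℝ, 0 < a ∧ Conforms (u - a • v) u ∧ supp (u - a • v) ⊂ supp u := by
  classical
  -- The smallest ratio marks the first coordinate to vanish as a multiple of `v` is subtracted.
  obtain ⟨e₀, he₀, hmin⟩ := (Finset.univ.filter fun e => 0 < v e * u e).exists_min_image
    (fun e => u e / v e) (by simpa [Finset.Nonempty] using hpos)
  simp only [Finset.mem_filter, Finset.mem_univ, true_and] at he₀ hmin
  have hv₀ : v e₀ ≠ 0 := fun h => by simp [h] at he₀
  have ha : 0 < u e₀ / v e₀ := by
    rw [show u e₀ / v e₀ = (v e₀ * u e₀) / v e₀ ^ 2 by field_simp]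
    positivity
  have hconf : Conforms (u - (u e₀ / v e₀) • v) u := by
    intro e he
    have hue : u e ≠ 0 := fun h => by
      have : v e = 0 := by
        by_contra hve
        exact hsupp hve h
      simp [h, this] at he
    refine lt_of_le_of_ne ?_ (mul_ne_zero he hue).symm
    simp only [PiLp.sub_apply, PiLp.smul_apply, smul_eq_mul]
    by_cases h : 0 < v e * u e
    · have hve : v e ≠ 0 := fun h' => by simp [h'] at h
      have := mul_le_mul_of_nonneg_right (hmin e h) h.le
      have h2 : u e / v e * (v e * u e) = u e * u e := by field_simp
      nlinarith
    · nlinarith [mul_self_nonneg (u e), mul_nonneg ha.le (neg_nonneg.2 (not_lt.1 h))]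
  refine ⟨_, ha, hconf, hconf.supp_subset, fun h => ?_⟩
  exact h (hsupp hv₀) (by simp [hv₀])

theorem ncard_supp_lt {u v : EuclideanSpace ℝ E} (h : supp u ⊂ supp v) :
    (supp u).ncard < (supp v).ncard := Set.ncard_lt_ncard h

theorem exists_ne_zero {u : EuclideanSpace ℝ E} (hu : u ≠ 0) : ∃ e, u e ≠ 0 := by
  by_contra! h
  exact hu (PiLp.ext h)

/-- Every nonzero flow has a circuit conforming to it. -/
theorem exists_circuit_conforms [Finite ρ] {A : Matrix ρ E ℝ} (hA : A.IsTotallyUnimodular)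
    {M : Matroid E} (hM : Represents A M) {w : EuclideanSpace ℝ E} (hw : w ∈ flowSpace A)
    (hw0 : w ≠ 0) : ∃ γ ∈ circuits A M, Conforms γ w := by
  classical
  induction hn : (supp w).ncard using Nat.strong_induction_on generalizing w with
  | _ n ih =>
  subst hn
  by_cases hmin : ∀ v ∈ flowSpace A, v ≠ 0 → supp v ⊆ supp w → supp v = supp w
  · obtain ⟨f, hf⟩ := exists_ne_zero hw0
    have hc : 0 < |w f|⁻¹ := by positivity
    have hsupp : supp (|w f|⁻¹ • w) = supp w := by
      ext e
      simp [supp, hf]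
    refine ⟨|w f|⁻¹ • w, ⟨⟨Submodule.smul_mem _ _ hw, smul_ne_zero hc.ne' hw0, fun e => ?_⟩, ?_⟩,
      (Conforms.refl w).smul hc⟩
    · by_cases he : w e = 0
      · simp [he]
      · have := abs_eq_abs_of_minimal_supp hA hw hmin he hf
        rw [← this]
        rcases lt_or_gt_of_ne he with h | h
        · left
          simp [abs_of_neg h, inv_neg, he]
        · right; right
          simp [abs_of_pos h, he]
    · rw [hsupp]
      exact isCircuit_supp_of_minimal hM hw hw0 hmin
  · push Not at hmin
    obtain ⟨v, hv, hv0, hvw, hne⟩ := hmin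
    -- Replacing `v` by `-v` if necessary makes it agree in sign with `w` somewhere.
    obtain ⟨v, hv, hvw, hne, hpos⟩ : ∃ v ∈ flowSpace A, supp v ⊆ supp w ∧ supp v ≠ supp w ∧
        ∃ e, 0 < v e * w e := by
      obtain ⟨e, he⟩ := exists_ne_zero hv0
      rcases lt_or_gt_of_ne (mul_ne_zero he (hvw he)) with h | h
      · have hs : supp (-v) = supp v := by ext; simp [supp]
        exact ⟨-v, neg_mem hv, hs ▸ hvw, hs ▸ hne, e, by simpa using h⟩
      · exact ⟨v, hv, hvw, hne, e, h⟩
    obtain ⟨a, ha, hconf, hss⟩ := exists_sub_smul_conforms hvw hpos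
    obtain ⟨e, he, hev⟩ := Set.exists_of_ssubset (hvw.ssubset_of_ne hne)
    have hmem : w - a • v ∈ flowSpace A := sub_mem hw (Submodule.smul_mem _ _ hv)
    have hne0 : w - a • v ≠ 0 := fun h => he (by
      have h1 := congrArg (fun x : EuclideanSpace ℝ E => x e) h
      have h2 : v e = 0 := by simpa [supp] using hev
      simpa [h2] using h1)
    obtain ⟨γ, hγ, hγc⟩ := ih _ (ncard_supp_lt hss) hmem hne0 rfl
    exact ⟨γ, hγ, hγc.trans hconf⟩

/-- Conformal decomposition: every nonzero flow `w` is `w' + a • γ` with a circuit `γ` and a flow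
`w'` of smaller support, both conforming to `w`. -/
theorem exists_conformal_step [Finite ρ] {A : Matrix ρ E ℝ} (hA : A.IsTotallyUnimodular)
    {M : Matroid E} (hM : Represents A M) {w : EuclideanSpace ℝ E} (hw : w ∈ flowSpace A)
    (hw0 : w ≠ 0) : ∃ γ ∈ circuits A M, Conforms γ w ∧ ∃ a : ℝ, 0 < a ∧
      Conforms (w - a • γ) w ∧ supp (w - a • γ) ⊂ supp w := by
  obtain ⟨γ, hγ, hγw⟩ := exists_circuit_conforms hA hM hw hw0
  obtain ⟨e, he⟩ := exists_ne_zero hγ.1.2.1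
  obtain ⟨a, h⟩ := exists_sub_smul_conforms hγw.supp_subset ⟨e, hγw e he⟩
  exact ⟨γ, hγ, hγw, a, h⟩

/-- As long as the circuits split off avoid `e`, the remainder keeps the entry `w e`; since its
support shrinks, some circuit eventually meets `e`. -/
theorem exists_circuit_conforms_apply_ne_zero [Finite ρ] {A : Matrix ρ E ℝ}
    (hA : A.IsTotallyUnimodular) {M : Matroid E} (hM : Represents A M)
    {w : EuclideanSpace ℝ E} (hw : w ∈ flowSpace A) {e : E} (he : w e ≠ 0) :
    ∃ γ ∈ circuits A M, Conforms γ w ∧ γ e ≠ 0 := by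
  induction hn : (supp w).ncard using Nat.strong_induction_on generalizing w with
  | _ n ih =>
  subst hn
  have hw0 : w ≠ 0 := fun h => he (by simp [h])
  obtain ⟨γ, hγ, hγw, a, ha, hconf, hss⟩ := exists_conformal_step hA hM hw hw0
  by_cases hγe : γ e = 0
  · obtain ⟨γ', hγ', hc, h0⟩ := ih _ (ncard_supp_lt hss)
      (sub_mem hw (Submodule.smul_mem _ _ hγ.1.1)) (by simpa [hγe] using he) rfl
    exact ⟨γ', hγ', hc.trans hconf, h0⟩
  · exact ⟨γ, hγ, hγw, hγe⟩

end Circuits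

/-! ### Faces of the Voronoi cell and sign vectors of flows -/

section Faces

variable {ρ E : Type*} [Fintype E]

theorem inner_eq_sum (x y : EuclideanSpace ℝ E) : inner ℝ x y = ∑ e, x e * y e := by
  simp [PiLp.inner_apply, mul_comm]

theorem norm_sq_eq_sum (x : EuclideanSpace ℝ E) : ‖x‖ ^ 2 = ∑ e, x e ^ 2 := by
  simp [EuclideanSpace.norm_sq_eq]

/-- The sum of the absolute values of the coordinates. -/
def oneNorm (w : EuclideanSpace ℝ E) : ℝ := ∑ e, |w e|

theorem oneNorm_smul {a : ℝ} (ha : 0 ≤ a) (w : EuclideanSpace ℝ E) :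
    oneNorm (a • w) = a * oneNorm w := by
  simp [oneNorm, abs_mul, Finset.mul_sum, abs_of_nonneg ha]

/-- The absolute values of vectors conforming to a common vector add up. -/
theorem oneNorm_add {u v w : EuclideanSpace ℝ E} (hu : Conforms u w) (hv : Conforms v w) :
    oneNorm (u + v) = oneNorm u + oneNorm v := by
  rw [oneNorm, oneNorm, oneNorm, ← Finset.sum_add_distrib]
  refine Finset.sum_congr rfl fun e _ => ?_
  by_cases h1 : u e = 0
  · simp [h1]
  by_cases h2 : v e = 0
  · simp [h2]
  have h3 := hu e h1
  have h4 := hv e h2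
  rw [PiLp.add_apply, abs_add_eq_add_abs_iff]
  rcases lt_or_gt_of_ne (hu.supp_subset h1) with h | h
  · right
    constructor <;> nlinarith
  · left
    constructor <;> nlinarith

theorem norm_sq_eq_oneNorm {A : Matrix ρ E ℝ} {γ : EuclideanSpace ℝ E} (h : IsEulerian A γ) :
    ‖γ‖ ^ 2 = oneNorm γ := by
  rw [norm_sq_eq_sum]
  refine Finset.sum_congr rfl fun e _ => ?_
  rcases h.2.2 e with h | h | h <;> simp [h]

theorem IsEulerian.mem_flowLattice {A : Matrix ρ E ℝ} {γ : EuclideanSpace ℝ E}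
    (h : IsEulerian A γ) : γ ∈ flowLattice A := by
  refine ⟨h.1, fun e => ?_⟩
  rcases h.2.2 e with h | h | h
  · exact ⟨-1, by simp [h]⟩
  · exact ⟨0, by simp [h]⟩
  · exact ⟨1, by simp [h]⟩

theorem mem_voronoiCell_zero_iff {A : Matrix ρ E ℝ} {x : EuclideanSpace ℝ E} :
    x ∈ voronoiCell A 0 ↔
      x ∈ flowSpace A ∧ ∀ μ ∈ flowLattice A, 2 * inner ℝ x μ ≤ ‖μ‖ ^ 2 := by
  refine and_congr_right fun _ => forall₂_congr fun μ _ => ?_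
  rw [sub_zero, ← sq_le_sq₀ (norm_nonneg _) (norm_nonneg _), norm_sub_sq_real]
  constructor <;> intro h <;> linarith

/-- The orthogonal projection of the cube `[-1/2, 1/2]^E` lies in the Voronoi cell. -/
theorem starProjection_mem_voronoiCell (A : Matrix ρ E ℝ) {c : EuclideanSpace ℝ E}
    (hc : ∀ e, |c e| ≤ 1 / 2) : (flowSpace A).starProjection c ∈ voronoiCell A 0 := by
  refine mem_voronoiCell_zero_iff.2 ⟨Submodule.starProjection_apply_mem _ _, fun μ hμ => ?_⟩
  rw [Submodule.inner_starProjection_left_eq_right,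
    Submodule.starProjection_eq_self_iff.2 hμ.1, inner_eq_sum, norm_sq_eq_sum, Finset.mul_sum]
  refine Finset.sum_le_sum fun e _ => ?_
  obtain ⟨n, hn⟩ := hμ.2 e
  -- Integrality of `μ` enters here.
  have h1 : |μ e| ≤ μ e ^ 2 := by
    rw [hn]
    have h : |n| ≤ n ^ 2 := by simpa using Int.natAbs_le_self_sq n
    have h' : |(n : ℝ)| ≤ (n : ℝ) ^ 2 := by exact_mod_cast h
    exact h'
  have h2 : c e * μ e ≤ |c e| * |μ e| := by
    rw [← abs_mul]
    exact le_abs_self _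
  nlinarith [hc e, abs_nonneg (μ e)]

theorem two_inner_le_oneNorm_of_isEulerian {A : Matrix ρ E ℝ} {x γ : EuclideanSpace ℝ E}
    (hx : x ∈ voronoiCell A 0) (h : IsEulerian A γ) : 2 * inner ℝ x γ ≤ oneNorm γ := by
  rw [← norm_sq_eq_oneNorm h]
  exact (mem_voronoiCell_zero_iff.1 hx).2 γ h.mem_flowLattice

/-- The inequality for circuits propagates along a conformal decomposition, on which the right-hand
side is additive. -/
theorem two_inner_le_oneNorm [Finite ρ] {A : Matrix ρ E ℝ}
    (hA : A.IsTotallyUnimodular) {M : Matroid E} (hM : Represents A M)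
    {x w : EuclideanSpace ℝ E} (hx : x ∈ voronoiCell A 0) (hw : w ∈ flowSpace A) :
    2 * inner ℝ x w ≤ oneNorm w := by
  induction hn : (supp w).ncard using Nat.strong_induction_on generalizing w with
  | _ n ih =>
  subst hn
  by_cases hw0 : w = 0
  · simp [hw0, oneNorm]
  obtain ⟨γ, hγ, hγw, a, ha, hconf, hss⟩ := exists_conformal_step hA hM hw hw0
  have h1 := ih _ (ncard_supp_lt hss) (sub_mem hw (Submodule.smul_mem _ _ hγ.1.1)) rfl
  have h2 := two_inner_le_oneNorm_of_isEulerian hx hγ.1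
  have h3 := oneNorm_add hconf (hγw.smul ha)
  rw [sub_add_cancel, oneNorm_smul ha.le] at h3
  rw [inner_sub_right, real_inner_smul_right] at h1
  nlinarith

/-- The center of the face of the cube `[-1/2, 1/2]^E` on which `w` attains its maximum. -/
def halfSign {E : Type*} (w : EuclideanSpace ℝ E) : EuclideanSpace ℝ E :=
  WithLp.toLp 2 fun e => (SignType.sign (w e) : ℝ) / 2

theorem halfSign_apply {E : Type*} (w : EuclideanSpace ℝ E) (e : E) :
    halfSign w e = (SignType.sign (w e) : ℝ) / 2 := rfl

theorem abs_halfSign_le {E : Type*} (w : EuclideanSpace ℝ E) (e : E) : |halfSign w e| ≤ 1 / 2 := by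
  rw [halfSign_apply]
  cases SignType.sign (w e) <;> norm_num

theorem two_halfSign_mul_le {E : Type*} (w u : EuclideanSpace ℝ E) (e : E) :
    2 * (halfSign w e * u e) ≤ |u e| := by
  have h2 : halfSign w e * u e ≤ |halfSign w e| * |u e| := (le_abs_self _).trans (abs_mul _ _).le
  nlinarith [abs_halfSign_le w e, abs_nonneg (u e)]

theorem two_inner_halfSign_self (w : EuclideanSpace ℝ E) :
    2 * inner ℝ (halfSign w) w = oneNorm w := by
  rw [inner_eq_sum, oneNorm, Finset.mul_sum]
  refine Finset.sum_congr rfl fun e _ => ?_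
  rw [← sign_mul_self (w e), halfSign_apply]
  ring

/-- The inequality holds coordinatewise, so equality of the sums forces equality in each coordinate.
-/
theorem conforms_of_two_inner_halfSign {u w : EuclideanSpace ℝ E}
    (h : 2 * inner ℝ (halfSign w) u = oneNorm u) : Conforms u w := by
  rw [inner_eq_sum, oneNorm, Finset.mul_sum,
    Finset.sum_eq_sum_iff_of_le fun e _ => two_halfSign_mul_le w u e] at h
  intro e he
  have := h e (Finset.mem_univ e)
  rw [halfSign_apply] at this
  have hpos := abs_pos.2 he
  rcases lt_trichotomy (w e) 0 with hw | hw | hw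
  · rw [sign_neg hw] at this
    norm_num at this
    nlinarith
  · rw [hw] at this
    simp at this
    exact absurd this.symm hpos.ne'
  · rw [sign_pos hw] at this
    norm_num at this
    nlinarith

/-- The face of the Voronoi cell in the direction of the flow `w`. -/
def faceSet (A : Matrix ρ E ℝ) (w : EuclideanSpace ℝ E) : Set (EuclideanSpace ℝ E) :=
  {x | x ∈ voronoiCell A 0 ∧ 2 * inner ℝ x w = oneNorm w}

/-- Coordinates outside the support of `w` are free within the cube. Taking `d = 0` shows the face
is nonempty; small `d` later supply its directions. -/
theorem starProjection_add_mem_faceSet {A : Matrix ρ E ℝ} {w d : EuclideanSpace ℝ E}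
    (hw : w ∈ flowSpace A) (hd : ∀ e, w e ≠ 0 → d e = 0) (hd' : ∀ e, |d e| ≤ 1 / 2) :
    (flowSpace A).starProjection (halfSign w + d) ∈ faceSet A w := by
  constructor
  · refine starProjection_mem_voronoiCell A fun e => ?_
    by_cases he : w e = 0
    · simpa [halfSign_apply, he] using hd' e
    · simpa [hd e he] using abs_halfSign_le w e
  · rw [Submodule.inner_starProjection_left_eq_right,
      Submodule.starProjection_eq_self_iff.2 hw, inner_add_left, mul_add,
      two_inner_halfSign_self, inner_eq_sum, add_eq_left, Finset.sum_eq_zero, mul_zero]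
    intro e _
    by_cases he : w e = 0
    · simp [he]
    · simp [hd e he]

theorem starProjection_halfSign_mem_faceSet {A : Matrix ρ E ℝ} {w : EuclideanSpace ℝ E}
    (hw : w ∈ flowSpace A) : (flowSpace A).starProjection (halfSign w) ∈ faceSet A w := by
  simpa using starProjection_add_mem_faceSet (d := 0) hw (by simp) (by simp)

theorem conforms_of_starProjection_mem {A : Matrix ρ E ℝ} {u w : EuclideanSpace ℝ E}
    (hu : u ∈ flowSpace A)
    (h : 2 * inner ℝ ((flowSpace A).starProjection (halfSign w)) u = oneNorm u) :
    Conforms u w := by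
  rw [Submodule.inner_starProjection_left_eq_right,
    Submodule.starProjection_eq_self_iff.2 hu] at h
  exact conforms_of_two_inner_halfSign h

/-- Finitely many strict sign conditions survive a small perturbation. -/
theorem exists_add_smul_conforms {u w : EuclideanSpace ℝ E} (h : supp u ⊆ supp w) :
    ∃ ε : ℝ, 0 < ε ∧ Conforms (w - ε • u) w ∧ Conforms (w + ε • u) w ∧
      Conforms w (w + ε • u) := by
  have hev : ∀ᶠ ε : ℝ in nhdsWithin 0 (Set.Ioi 0),
      ∀ e, w e ≠ 0 → 0 < (w e - ε * u e) * w e ∧ 0 < (w e + ε * u e) * w e := by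
    refine nhdsWithin_le_nhds (Filter.eventually_all.2 fun e => ?_)
    by_cases he : w e = 0
    · simp [he]
    · have hp : 0 < w e * w e := mul_self_pos.2 he
      have c1 : Continuous fun ε : ℝ => (w e - ε * u e) * w e := by fun_prop
      have c2 : Continuous fun ε : ℝ => (w e + ε * u e) * w e := by fun_prop
      have hp1 : 0 < (w e - 0 * u e) * w e := by rwa [zero_mul, sub_zero]
      have hp2 : 0 < (w e + 0 * u e) * w e := by rwa [zero_mul, add_zero]
      filter_upwards [(c1.tendsto 0).eventually (lt_mem_nhds hp1),
        (c2.tendsto 0).eventually (lt_mem_nhds hp2)] with ε h1 h2 _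
      exact ⟨h1, h2⟩
  obtain ⟨ε, hε, hpos⟩ := (hev.and self_mem_nhdsWithin).exists
  have hz : ∀ e, w e = 0 → u e = 0 := fun e he => by
    by_contra hu
    exact h hu he
  refine ⟨ε, hpos, fun e he => ?_, fun e he => ?_, fun e he => ?_⟩
  · have hw : w e ≠ 0 := fun hw => he (by simp [hw, hz e hw])
    simpa using (hε e hw).1
  · have hw : w e ≠ 0 := fun hw => he (by simp [hw, hz e hw])
    simpa using (hε e hw).2
  · simpa [mul_comm] using (hε e he).2

variable [Finite ρ] {A : Matrix ρ E ℝ} {M : Matroid E}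

/-- The projection of `halfSign w` is tight only for flows conforming to `w`. Conversely, `w` is the
conformal sum of `w - ε • u` and `ε • u`, so tightness for `w` forces it for both summands. -/
theorem faceSet_subset_faceSet_iff (hA : A.IsTotallyUnimodular) (hM : Represents A M)
    {u w : EuclideanSpace ℝ E} (hu : u ∈ flowSpace A) (hw : w ∈ flowSpace A) :
    faceSet A w ⊆ faceSet A u ↔ Conforms u w := by
  constructor
  · intro h
    exact conforms_of_starProjection_mem hu (h (starProjection_halfSign_mem_faceSet hw)).2
  · rintro h x ⟨hx, hxw⟩
    refine ⟨hx, ?_⟩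
    obtain ⟨ε, hε, hc, -⟩ := exists_add_smul_conforms h.supp_subset
    have h1 := two_inner_le_oneNorm hA hM hx (sub_mem hw (Submodule.smul_mem _ ε hu))
    have h2 := two_inner_le_oneNorm hA hM hx hu
    have h3 := oneNorm_add hc (h.smul hε)
    rw [sub_add_cancel, oneNorm_smul hε.le] at h3
    rw [inner_sub_right, real_inner_smul_right] at h1
    nlinarith

theorem isExposed_faceSet (hA : A.IsTotallyUnimodular) (hM : Represents A M)
    {w : EuclideanSpace ℝ E} (hw : w ∈ flowSpace A) :
    IsExposed ℝ (voronoiCell A 0) (faceSet A w) := by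
  refine fun _ => ⟨innerSL ℝ w, ?_⟩
  ext x
  simp only [faceSet, Set.mem_ofPred_eq, innerSL_apply_apply, fun y => real_inner_comm y w]
  refine and_congr_right fun hx => ⟨fun h y hy => ?_, fun h => ?_⟩
  · linarith [two_inner_le_oneNorm hA hM hy hw]
  · have h1 := starProjection_halfSign_mem_faceSet hw
    linarith [h _ h1.1, h1.2, two_inner_le_oneNorm hA hM hx hw]

/-- The face of the Voronoi cell in the direction of the flow `w`, as a member of the poset. -/
def face (hA : A.IsTotallyUnimodular) (hM : Represents A M)
    {w : EuclideanSpace ℝ E} (hw : w ∈ flowSpace A) : FacePoset A :=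
  ⟨faceSet A w, ⟨_, starProjection_halfSign_mem_faceSet hw⟩, isExposed_faceSet hA hM hw⟩

/-- The cell lies in the flow space, so only the projection of the functional's Riesz vector to that
space matters. -/
theorem exists_eq_faceSet (hA : A.IsTotallyUnimodular) (hM : Represents A M) (F : FacePoset A) :
    ∃ w ∈ flowSpace A, F.1 = faceSet A w := by
  obtain ⟨F, hne, hF⟩ := F
  obtain ⟨l, rfl⟩ := hF hne
  set w := (flowSpace A).starProjection ((InnerProductSpace.toDual ℝ _).symm l) with hwdef
  have hw : w ∈ flowSpace A := Submodule.starProjection_apply_mem _ _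
  have hl : ∀ x ∈ voronoiCell A 0, l x = inner ℝ x w := by
    intro x hx
    rw [hwdef, ← Submodule.inner_starProjection_left_eq_right,
      Submodule.starProjection_eq_self_iff.2 hx.1, real_inner_comm,
      InnerProductSpace.toDual_symm_apply]
  refine ⟨w, hw, ?_⟩
  ext x
  refine and_congr_right fun hx => ⟨fun h => ?_, fun h y hy => ?_⟩
  · have h1 := starProjection_halfSign_mem_faceSet hw
    have h2 := h _ h1.1
    rw [hl _ hx, hl _ h1.1] at h2
    linarith [h1.2, two_inner_le_oneNorm hA hM hx hw]
  · rw [hl _ hx, hl _ hy]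
    linarith [two_inner_le_oneNorm hA hM hy hw]

/-- Since `‖γ‖² = ‖γ‖₁`, the hyperplane of `γ` meets the cell exactly in `faceSet A γ`. -/
theorem mem_circuitsThrough_iff (hA : A.IsTotallyUnimodular) (hM : Represents A M)
    {F : FacePoset A} {w γ : EuclideanSpace ℝ E} (hw : w ∈ flowSpace A) (hF : F.1 = faceSet A w) :
    γ ∈ circuitsThrough A M F ↔ γ ∈ circuits A M ∧ Conforms γ w := by
  refine and_congr_right fun hγ => ?_
  rw [← faceSet_subset_faceSet_iff hA hM hγ.1.1 hw, hF]
  refine forall₂_congr fun x hx => ?_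
  simp [hyperplane, faceSet, norm_sq_eq_oneNorm hγ.1, hx.1, hx.1.1]

theorem biUnion_supp_circuitsThrough (hA : A.IsTotallyUnimodular) (hM : Represents A M)
    {F : FacePoset A} {w : EuclideanSpace ℝ E} (hw : w ∈ flowSpace A) (hF : F.1 = faceSet A w) :
    ⋃ γ ∈ circuitsThrough A M F, supp γ = supp w := by
  ext e
  simp only [Set.mem_iUnion, exists_prop, mem_circuitsThrough_iff hA hM hw hF]
  constructor
  · rintro ⟨γ, ⟨-, h⟩, he⟩
    exact h.supp_subset he
  · intro he
    obtain ⟨γ, hγ, hc, h⟩ := exists_circuit_conforms_apply_ne_zero hA hM hw he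
    exact ⟨γ, ⟨hγ, hc⟩, h⟩

end Faces

/-! ### Flows of a submatroid as flows with restricted support -/

section FlowsOn

variable {ρ E : Type*}

/-- The vectors supported on `S`. -/
def vectorsOn (S : Set E) : Submodule ℝ (EuclideanSpace ℝ E) where
  carrier := {x | ∀ e ∉ S, x e = 0}
  zero_mem' := fun _ _ => rfl
  add_mem' hx hy := fun e he => by simp [hx e he, hy e he]
  smul_mem' a x hx := fun e he => by simp [hx e he]

theorem mem_vectorsOn_iff_supp_subset {S : Set E} {x : EuclideanSpace ℝ E} :
    x ∈ vectorsOn S ↔ supp x ⊆ S :=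
  forall_congr' fun _ => not_imp_comm

open Classical in
/-- Extension of a vector by zero. -/
def extendZero {S : Set E} (x : EuclideanSpace ℝ S) : EuclideanSpace ℝ E :=
  WithLp.toLp 2 fun e => if h : e ∈ S then x ⟨e, h⟩ else 0

theorem extendZero_apply_coe {S : Set E} (x : EuclideanSpace ℝ S) (e : S) :
    extendZero x e = x e := by
  simp [extendZero]

theorem extendZero_apply_of_notMem {S : Set E} (x : EuclideanSpace ℝ S) {e : E} (he : e ∉ S) :
    extendZero x e = 0 := by
  simp [extendZero, he]

theorem extendZero_restrict {S : Set E} {y : EuclideanSpace ℝ E} (hy : y ∈ vectorsOn S) :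
    extendZero (WithLp.toLp 2 fun e : S => y e) = y := by
  ext e
  by_cases he : e ∈ S
  · exact extendZero_apply_coe _ ⟨e, he⟩
  · rw [extendZero_apply_of_notMem _ he, hy e he]

variable [Fintype E]

/-- The flows supported on `S`. -/
def flowsOn (A : Matrix ρ E ℝ) (S : Set E) : Submodule ℝ (EuclideanSpace ℝ E) :=
  flowSpace A ⊓ vectorsOn S

theorem extendZero_mem_flowSpace_iff {A : Matrix ρ E ℝ} {S : Set E} [Fintype S]
    {x : EuclideanSpace ℝ S} :
    extendZero x ∈ flowSpace A ↔ x ∈ flowSpace (columns A S) := by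
  rw [mem_flowSpace_iff, mem_flowSpace_iff]
  refine forall_congr' fun i => ?_
  rw [Fintype.sum_of_injective ((↑) : S → E) Subtype.val_injective
    (fun e => columns A S i e * x e) (fun e => A i e * extendZero x e)]
  · intro e he
    rw [extendZero_apply_of_notMem x (by simpa using he), mul_zero]
  · intro e
    rw [extendZero_apply_coe]
    rfl

/-- Flows of the submatrix of the columns in `S` are flows supported on `S`. -/
def flowSpaceColumnsEquiv (A : Matrix ρ E ℝ) (S : Set E) [Fintype S] :
    flowSpace (columns A S) ≃ₗ[ℝ] flowsOn A S where
  toFun x := ⟨extendZero x.1, extendZero_mem_flowSpace_iff.2 x.2,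
    fun _ he => extendZero_apply_of_notMem _ he⟩
  map_add' x y := by
    ext e
    by_cases he : e ∈ S <;> simp [extendZero, he]
  map_smul' a x := by
    ext e
    by_cases he : e ∈ S <;> simp [extendZero, he]
  invFun y := ⟨WithLp.toLp 2 fun e : S => y.1 e, extendZero_mem_flowSpace_iff.1
    ((extendZero_restrict y.2.2).symm ▸ y.2.1)⟩
  left_inv x := by
    ext e
    exact extendZero_apply_coe _ e
  right_inv y := Subtype.ext (extendZero_restrict y.2.2)

theorem genus_columns (A : Matrix ρ E ℝ) (S : Set E) [Fintype S] :
    genus (columns A S) = Module.finrank ℝ (flowsOn A S) :=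
  (flowSpaceColumnsEquiv A S).finrank_eq

end FlowsOn

/-! ### Directions and dimension of a face -/

section Dimension

variable {ρ E : Type*} [Fintype E]

/-- The orthogonal complement of an intersection is the sum of the complements; the summand
orthogonal to the flow space is killed by the projection. -/
theorem exists_eq_starProjection {A : Matrix ρ E ℝ} {S : Set E} {y : EuclideanSpace ℝ E}
    (hy : y ∈ flowSpace A) (hyS : y ∈ (flowsOn A S)ᗮ) :
    ∃ d : EuclideanSpace ℝ E, (∀ e ∈ S, d e = 0) ∧ (flowSpace A).starProjection d = y := by
  classical
  have hsup : (flowsOn A S)ᗮ = (flowSpace A)ᗮ ⊔ (vectorsOn S)ᗮ := by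
    rw [← Submodule.orthogonal_orthogonal ((flowSpace A)ᗮ ⊔ (vectorsOn S)ᗮ),
      ← Submodule.inf_orthogonal, Submodule.orthogonal_orthogonal,
      Submodule.orthogonal_orthogonal, flowsOn]
  rw [hsup] at hyS
  obtain ⟨f, hf, d, hd, rfl⟩ := Submodule.mem_sup.1 hyS
  refine ⟨d, fun e he => ?_, ?_⟩
  · have := (Submodule.mem_orthogonal _ _).1 hd (EuclideanSpace.single e 1) fun e' he' => by
      rw [PiLp.single_apply, if_neg]
      rintro rfl
      exact he' he
    rwa [EuclideanSpace.inner_single_left, map_one, one_mul] at this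
  · conv_rhs => rw [← Submodule.starProjection_eq_self_iff.2 hy]
    rw [map_add, (Submodule.starProjection_apply_eq_zero_iff _).2 hf, zero_add]

variable [Finite ρ] {A : Matrix ρ E ℝ} {M : Matroid E}

/-- If `u` is supported on `supp w`, then `w + ε • u` is tight on the same face, so `⟨·, u⟩` is
constant there. The remaining directions are projections of cube directions off the support. -/
theorem vectorSpan_faceSet (hA : A.IsTotallyUnimodular) (hM : Represents A M)
    {w : EuclideanSpace ℝ E} (hw : w ∈ flowSpace A) :
    vectorSpan ℝ (faceSet A w) = (flowsOn A (supp w))ᗮ ⊓ flowSpace A := by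
  apply le_antisymm
  · refine Submodule.span_le.2 ?_
    rintro _ ⟨x, hx, y, hy, rfl⟩
    refine ⟨(Submodule.mem_orthogonal _ _).2 fun u hu => ?_, sub_mem hx.1.1 hy.1.1⟩
    obtain ⟨ε, hε, -, h, -⟩ := exists_add_smul_conforms (mem_vectorsOn_iff_supp_subset.1 hu.2)
    have hsub := (faceSet_subset_faceSet_iff hA hM
      (add_mem hw (Submodule.smul_mem _ ε hu.1)) hw).2 h
    have hx' := (hsub hx).2
    have hy' := (hsub hy).2
    rw [inner_add_right, real_inner_smul_right] at hx' hy'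
    have : ε * (inner ℝ x u - inner ℝ y u) = 0 := by linarith [hx.2, hy.2]
    have := (mul_eq_zero.1 this).resolve_left hε.ne'
    change inner ℝ u (x - y) = 0
    rwa [real_inner_comm, inner_sub_left]
  · rintro y ⟨hyo, hy⟩
    obtain ⟨d, hd, rfl⟩ := exists_eq_starProjection hy hyo
    -- This scale makes every entry of `ε • d` at most 1/2 in absolute value.
    set ε : ℝ := 1 / (2 * (‖d‖ + 1)) with hε
    have hpos : 0 < ε := by positivity
    have h1 : (flowSpace A).starProjection (halfSign w + ε • d) ∈ faceSet A w := by
      refine starProjection_add_mem_faceSet hw (fun e he => ?_) fun e => ?_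
      · simp [hd e he]
      · have h2 : |d e| ≤ ‖d‖ := PiLp.norm_apply_le d e
        rw [PiLp.smul_apply, smul_eq_mul, abs_mul, abs_of_pos hpos, hε, div_mul_eq_mul_div,
          div_le_div_iff₀ (by positivity) (by norm_num)]
        linarith
    have h2 := vsub_mem_vectorSpan ℝ h1 (starProjection_halfSign_mem_faceSet hw)
    rw [vsub_eq_sub, map_add, add_sub_cancel_left, map_smul] at h2
    exact (Submodule.smul_mem_iff _ hpos.ne').1 h2

theorem finrank_flowsOn_add_faceDim (hA : A.IsTotallyUnimodular) (hM : Represents A M)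
    {F : FacePoset A} {w : EuclideanSpace ℝ E} (hw : w ∈ flowSpace A) (hF : F.1 = faceSet A w) :
    Module.finrank ℝ (flowsOn A (supp w)) + faceDim A F = Module.finrank ℝ (flowSpace A) := by
  rw [faceDim, hF, vectorSpan_faceSet hA hM hw]
  exact Submodule.finrank_add_inf_finrank_orthogonal inf_le_left

/-- A strictly smaller face has a strictly larger support, and `w` itself is a flow on it that is
not supported on the old one. -/
theorem strictMono_faceDim (hA : A.IsTotallyUnimodular) (hM : Represents A M) :
    StrictMono (faceDim A) := by
  intro F F' hlt
  obtain ⟨w, hw, hF⟩ := exists_eq_faceSet hA hM F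
  obtain ⟨w', hw', hF'⟩ := exists_eq_faceSet hA hM F'
  have h1 : faceSet A w ⊆ faceSet A w' := hF ▸ hF' ▸ hlt.le
  have hc := (faceSet_subset_faceSet_iff hA hM hw' hw).1 h1
  have h2 : ¬ supp w ⊆ supp w' := by
    intro hs
    refine hlt.not_ge ?_
    change F'.1 ⊆ F.1
    rw [hF, hF', faceSet_subset_faceSet_iff hA hM hw hw']
    intro e he
    simpa [mul_comm] using hc e (hs he)
  have hlt' : flowsOn A (supp w') < flowsOn A (supp w) := by
    refine lt_of_le_not_ge (fun x hx => ⟨hx.1, fun e he => hx.2 e fun h => he (hc.supp_subset h)⟩)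
      fun h => h2 (mem_vectorsOn_iff_supp_subset.1 (h ⟨hw, ?_⟩).2)
    exact mem_vectorsOn_iff_supp_subset.2 subset_rfl
  have := Submodule.finrank_lt_finrank_of_lt hlt'
  have := finrank_flowsOn_add_faceDim hA hM hw hF
  have := finrank_flowsOn_add_faceDim hA hM hw' hF'
  omega

end Dimension

/-! ### Strongly connected orientations as sign vectors of flows -/

section Signs

variable {ρ E : Type*} [Fintype E] {A : Matrix ρ E ℝ} {M : Matroid E}

/-- The pair `s` is the support of `w` with the orientation given by the signs of `w`. -/
def SC.IsSignOf (s : SC A M) (w : EuclideanSpace ℝ E) : Prop :=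
  s.sub.E = supp w ∧ ∀ e : s.sub.E, 0 < ((s.orient e : ℤ) : ℝ) * w e

theorem cast_unit_eq_or (u : ℤˣ) : ((u : ℤ) : ℝ) = 1 ∨ ((u : ℤ) : ℝ) = -1 := by
  rcases Int.units_eq_one_or u with rfl | rfl <;> simp

theorem SC.IsSignOf.orient_eq_sign {s : SC A M} {w γ : EuclideanSpace ℝ E} (h : s.IsSignOf w)
    (hc : Conforms γ w) (e : E) (he : e ∈ s.sub.E) (hγ : e ∈ supp γ) :
    (s.orient ⟨e, he⟩ : ℤ) = (SignType.sign (γ e) : ℤ) := by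
  have h1 := h.2 ⟨e, he⟩
  have h2 := hc e hγ
  rcases Int.units_eq_one_or (s.orient ⟨e, he⟩) with hu | hu
  · rw [hu] at h1 ⊢
    have : 0 < w e := by simpa using h1
    rw [sign_pos (pos_of_mul_pos_left h2 this.le)]
    simp
  · rw [hu] at h1 ⊢
    have : w e < 0 := by simpa using h1
    rw [sign_neg (neg_of_mul_pos_left h2 this.le)]
    simp

theorem SC.sub_eq_restrict (s : SC A M) {S : Set E} (h : s.sub.E = S) : s.sub = M.restrict S := by
  rw [← h, s.isRestriction.eq_restrict]

theorem SC.IsSignOf.le_iff {s s' : SC A M} {w w' : EuclideanSpace ℝ E} (h : s.IsSignOf w)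
    (h' : s'.IsSignOf w') : s ≤ s' ↔ Conforms w' w := by
  constructor
  · rintro ⟨hr, ho⟩ e he
    have he' : e ∈ s'.sub.E := h'.1 ▸ he
    have hs : e ∈ s.sub.E := hr.subset he'
    have h1 := h.2 ⟨e, hs⟩
    have h2 := h'.2 ⟨e, he'⟩
    rw [ho e hs he'] at h2
    rcases cast_unit_eq_or (s.orient ⟨e, hs⟩) with hu | hu <;> rw [hu] at h1 h2 <;>
      nlinarith
  · intro hc
    refine ⟨?_, fun e hs he' => ?_⟩
    · rw [s.sub_eq_restrict h.1, s'.sub_eq_restrict h'.1]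
      exact Matroid.IsRestriction.of_subset M hc.supp_subset
    · have he : e ∈ supp w' := h'.1 ▸ he'
      exact Units.ext ((h'.orient_eq_sign (Conforms.refl w') e he' he).trans
        (h.orient_eq_sign hc e hs he).symm)

/-- Every strongly connected pair is given by the signs of a flow. -/
theorem SC.exists_isSignOf (s : SC A M) : ∃ w ∈ flowSpace A, s.IsSignOf w := by
  classical
  have hsc := s.stronglyConnected
  choose z hz using hsc
  let v := fun e : s.sub.E => EuclideanSpace.single e (1 : ℝ) +
    WithLp.toLp 2 (fun f => (z e f : ℝ))
  have hv : ∀ e, v e ∈ flowSpace (reorient (columns A s.sub.E) s.orient) := by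
    intro e
    convert (hz e).1
  have hsum := sum_mem fun e (_ : e ∈ Finset.univ) => hv e
  -- Summing the nonnegative flows over all `e` gives a flow of the reoriented matrix that is
  -- positive everywhere; undoing the reorientation gives the required signs.
  set x := ∑ e, v e with hx
  have hvnn : ∀ e f, 0 ≤ v e f := by
    intro e f
    simp only [v, PiLp.add_apply, PiLp.single_apply]
    positivity
  have hxpos : ∀ f, 0 < x f := by
    intro f
    rw [hx, WithLp.ofLp_sum, Finset.sum_apply]
    refine Finset.sum_pos' (fun e _ => hvnn e f) ⟨f, Finset.mem_univ _, ?_⟩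
    simp only [v, PiLp.add_apply, PiLp.single_apply, if_true]
    positivity
  have hy := mem_flowSpace_iff.1 hsum
  let y : EuclideanSpace ℝ s.sub.E := WithLp.toLp 2 fun e => ((s.orient e : ℤ) : ℝ) * x e
  have hys : ∀ e : s.sub.E, 0 < ((s.orient e : ℤ) : ℝ) * y e := by
    intro e
    have := hxpos e
    rcases cast_unit_eq_or (s.orient e) with hu | hu <;> simpa [y, hu] using this
  refine ⟨extendZero y, extendZero_mem_flowSpace_iff.2 (mem_flowSpace_iff.2 fun i => ?_), ?_, ?_⟩
  · rw [← hy i]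
    refine Finset.sum_congr rfl fun e _ => ?_
    simp only [y, reorient, Matrix.of_apply]
    rw [hx]
    ring
  · ext e
    constructor
    · intro he h
      have := hys ⟨e, he⟩
      rw [← extendZero_apply_coe y ⟨e, he⟩, h] at this
      simp at this
    · intro he
      by_contra h
      exact he (extendZero_apply_of_notMem y h)
  · intro e
    rw [extendZero_apply_coe]
    exact hys e

theorem stronglyConnected_of_exists {B : Matrix ρ E ℝ}
    (h : ∀ e, ∃ γ ∈ flowSpace B, γ e = 1 ∧ ∀ f, γ f = 0 ∨ γ f = 1) : StronglyConnected B := by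
  classical
  intro e
  obtain ⟨γ, hγ, he, h01⟩ := h e
  -- The vector `z` is `γ` with its unit at `e` removed.
  refine ⟨fun f => if f = e ∨ γ f = 0 then 0 else 1, ?_⟩
  have hγ' : γ ∈ flowLattice B := by
    refine ⟨hγ, fun f => ?_⟩
    rcases h01 f with hf | hf
    · exact ⟨0, by simp [hf]⟩
    · exact ⟨1, by simp [hf]⟩
  convert hγ'
  ext f
  by_cases hfe : f = e
  · subst hfe
    simp [he]
  · rcases h01 f with hf | hf <;> simp [hfe, hf]

/-- The orientation of the support of a flow by its signs is strongly connected. -/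
theorem stronglyConnected_supp [Finite ρ] (hA : A.IsTotallyUnimodular) (hM : Represents A M)
    {w : EuclideanSpace ℝ E} [Fintype (supp w)] (hw : w ∈ flowSpace A) {D : E → ℤˣ}
    (hD : ∀ e, w e ≠ 0 → 0 < ((D e : ℤ) : ℝ) * w e) :
    StronglyConnected (reorient (columns A (supp w)) fun e => D e) := by
  refine stronglyConnected_of_exists fun e => ?_
  -- After reorientation by the signs of `w`, a circuit conforming to `w` becomes a 0/1 flow.
  obtain ⟨γ, hγ, hc, hγe⟩ := exists_circuit_conforms_apply_ne_zero hA hM hw e.2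
  have hDγ : ∀ f, γ f ≠ 0 → ((D f : ℤ) : ℝ) * γ f = 1 := by
    intro f h0
    have h1 := hD f (hc.supp_subset h0)
    have h2 := hc f h0
    rcases cast_unit_eq_or (D f) with hu | hu <;> rw [hu] at h1 ⊢ <;>
      rcases hγ.1.2.2 f with h | h | h <;> rw [h] at h2 ⊢ <;> linarith
  refine ⟨WithLp.toLp 2 fun f => ((D f : ℤ) : ℝ) * γ f, mem_flowSpace_iff.2 fun i => ?_,
    hDγ e hγe, fun f => ?_⟩
  · rw [← mem_flowSpace_iff.1 hγ.1.1 i]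
    refine Fintype.sum_of_injective ((↑) : supp w → E) Subtype.val_injective _ _ ?_ ?_
    · intro f hf
      have : γ f = 0 := by
        by_contra h0
        exact hf ⟨⟨f, hc.supp_subset h0⟩, rfl⟩
      simp [this]
    · intro f
      rcases cast_unit_eq_or (D f) with hu | hu <;> simp [reorient, columns, hu]
  · by_cases h0 : γ f = 0
    · simp [h0]
    · exact Or.inr (hDγ f h0)

/-- The signs of a flow are a strongly connected pair. -/
theorem exists_SC_isSignOf [Finite ρ] (hA : A.IsTotallyUnimodular) (hM : Represents A M)
    {w : EuclideanSpace ℝ E} (hw : w ∈ flowSpace A) : ∃ s : SC A M, s.IsSignOf w := by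
  classical
  -- The value off the support of `w` is irrelevant, as `D` is restricted to the support.
  let D : E → ℤˣ := fun e => if 0 < w e then 1 else -1
  have hD : ∀ e, w e ≠ 0 → 0 < ((D e : ℤ) : ℝ) * w e := by
    intro e he
    by_cases h : 0 < w e
    · simp [D, h]
    · simpa [D, h] using lt_of_le_of_ne (not_lt.1 h) he
  exact ⟨⟨M.restrict (supp w), Matroid.restrict_isRestriction M _ (by simp [hM.1]),
    fun e => D e, stronglyConnected_supp hA hM hw hD⟩, rfl, fun e => hD e e.2⟩

theorem SC.IsSignOf.genus_eq {s : SC A M} {w : EuclideanSpace ℝ E} (h : s.IsSignOf w) :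
    s.genus = Module.finrank ℝ (flowsOn A (supp w)) := by
  classical
  rw [← h.1]
  exact genus_columns A s.sub.E

end Signs

end RegularFlow

end

/-! ### The isomorphism of graded posets -/

theorem mainTheorem1 {ρ E : Type*} [Finite ρ] [Fintype E] (M : Matroid E) (A : Matrix ρ E ℝ)
    (hTU : A.IsTotallyUnimodular) (hA : RegularFlow.Represents A M) :
    StrictMono (RegularFlow.faceDim A) ∧
    StrictMono (RegularFlow.SC.degree (A := A) (M := M)) ∧
    ∃ φ : RegularFlow.FacePoset A ≃o RegularFlow.SC A M,
      (∀ F : RegularFlow.FacePoset A,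
        (φ F).sub = M.restrict (⋃ γ ∈ RegularFlow.circuitsThrough A M F, RegularFlow.supp γ) ∧
        (∀ γ ∈ RegularFlow.circuitsThrough A M F, ∀ (e : E) (he : e ∈ (φ F).sub.E),
          e ∈ RegularFlow.supp γ → ((φ F).orient ⟨e, he⟩ : ℤ) = (SignType.sign (γ e) : ℤ))) ∧
      (∀ F : RegularFlow.FacePoset A, RegularFlow.faceCodim A F = ((φ F).genus : ℤ)) ∧
      (∀ F : RegularFlow.FacePoset A, (RegularFlow.faceDim A F : ℤ) = (φ F).degree) := by
  open RegularFlow in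
  choose w hw hF using exists_eq_faceSet hTU hA
  choose f hf using fun F => exists_SC_isSignOf hTU hA (hw F)
  have hle : ∀ F F', f F ≤ f F' ↔ F ≤ F' := by
    intro F F'
    rw [(hf F).le_iff (hf F'), ← faceSet_subset_faceSet_iff hTU hA (hw F') (hw F), ← hF, ← hF]
    rfl
  have hsurj : Function.Surjective f := by
    intro s
    obtain ⟨u, hu, hs⟩ := s.exists_isSignOf
    -- The flow chosen for this face may differ from `u`, but the two define the same face and hence
    -- conform to each other.
    refine ⟨face hTU hA hu, le_antisymm ?_ ?_⟩
    · rw [(hf _).le_iff hs, ← faceSet_subset_faceSet_iff hTU hA hu (hw _), ← hF]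
      rfl
    · rw [hs.le_iff (hf _), ← faceSet_subset_faceSet_iff hTU hA (hw _) hu, ← hF]
      rfl
  let φ : FacePoset A ≃o SC A M := RelIso.ofSurjective (OrderEmbedding.ofMapLEIff f hle) hsurj
  have hφ : ∀ F, (φ F).IsSignOf (w F) := hf
  have hcodim : ∀ F, faceCodim A F = ((φ F).genus : ℤ) := by
    intro F
    have := finrank_flowsOn_add_faceDim hTU hA (hw F) (hF F)
    rw [faceCodim, (hφ F).genus_eq]
    omega
  have hdim : ∀ F, (faceDim A F : ℤ) = (φ F).degree := by
    intro F
    rw [SC.degree, ← hcodim F, faceCodim, genus, sub_sub_cancel]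
  have hmono := strictMono_faceDim hTU hA
  refine ⟨hmono, fun s s' hss => ?_, φ, fun F => ⟨?_, fun γ hγ => ?_⟩, hcodim, hdim⟩
  · have h1 := hmono (φ.symm.strictMono hss)
    have h2 := hdim (φ.symm s)
    have h3 := hdim (φ.symm s')
    rw [φ.apply_symm_apply] at h2 h3
    omega
  · rw [biUnion_supp_circuitsThrough hTU hA (hw F) (hF F)]
    exact (φ F).sub_eq_restrict (hφ F).1
  · exact (hφ F).orient_eq_sign ((mem_circuitsThrough_iff hTU hA (hw F) (hF F)).1 hγ).2
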